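/- **Theorem.** Consider an instance $\mathcal I$ of the binary optimization problem $$(\mathrm{BO})\qquad \min\ c^Tx+d^Ty\quad\text{s.t.}\quad f_i(x)\ge 0\ (i=1,\dots,m),\quad g_j(x)=y_j\ (j=1,\dots,p),\quad x\in\{0,1\}^n,\ y\in\mathbb R^p,$$ where $c\in\mathbb R^n$, $d\in\mathbb R^p$ and $f_i,g_j:\{0,1\}^n\to\mathbb R$ are arbitrary functions, and let $F\subseteq\mathbb R^n\times\mathbb R^p$ be its set of feasible points $(x,y)$. The intersection graph $\Gamma[\mathcal I]$ has one vertex for each variable $x_1,\dots,x_n$, and two distinct variables are adjacent if both appear in a common constraint; here $x_k$ appears in the constraint $f_i(x)\ge 0$ (resp. $g_j(x)=y_j$) if the value of $f_i$ (resp. $g_j$) depends on the $k$-th coordinate, i.e. changes for some argument in $\{0,1\}^n$ when only that coordinate is changed. A tree-decomposition $(T,Q)$ of a graph $G$ consists of a finite tree $T$ and bags $Q_t\subseteq V(G)$, $t\in V(T)$, such that for each $v\in V(G)$ the set $\{t: v\in Q_t\}$ induces a (nonempty) subtree of $T$, and each edge of $G$ is contained in some bag; its width is $\max_t|Q_t|-1$.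 There is an absolute constant $C$ such that the following holds for every instance $\mathcal I$ of BO. If $\Gamma[\mathcal I]$ has a tree-decomposition $(T,Q)$ of width $\omega$, then there is an exact linear programming reformulation of $\mathcal I$ with at most $C\,2^{\omega}(|V(T)|+p)$ variables and at most $C\,2^{\omega}(|V(T)|+p)$ constraints. That is, there are a linear program $\min\{\gamma^Tz: Az\ge b,\ z\in\mathbb R^N\}$ with $N$ variables and $M$ inequality constraints, where $N,M\le C\,2^{\omega}(|V(T)|+p)$, and a linear map $\pi:\mathbb R^N\to\mathbb R^n\times\mathbb R^p$ such that $\pi(\{z:Az\ge b\})=\operatorname{conv}(F)$, such that $\gamma^Tz=c^Tx+d^Ty$ whenever $\pi(z)=(x,y)$, and such that the linear program and $\mathcal I$ have the same minimum (one is attained if and only if the other is). -/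

import Mathlib

/-- An instance of the binary optimization problem
`min cᵀx + dᵀy` subject to `f i x ≥ 0` for all `i`, `g j x = y j` for all `j`,
`x ∈ {0,1}ⁿ`, `y ∈ ℝᵖ`. The functions `f i`, `g j` on `{0,1}ⁿ` are arbitrary;
`{0,1}ⁿ` is represented by `Fin n → Bool`. -/
structure BinaryProblem (n m p : ℕ) where
  c : Fin n → ℝ
  d : Fin p → ℝ
  f : Fin m → (Fin n → Bool) → ℝ
  g : Fin p → (Fin n → Bool) → ℝ

/-- The 0/1 vector in `ℝⁿ` given by a Boolean vector. -/
def zeroOneVec {n : ℕ} (x : Fin n → Bool) : Fin n → ℝ :=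
  fun i => if x i then 1 else 0

/-- The variables that appear in a function on `{0,1}ⁿ`: those coordinates `i` such that changing
the `i`-th entry of some argument changes the value. -/
def varSupport {n : ℕ} (h : (Fin n → Bool) → ℝ) : Set (Fin n) :=
  {i | ∃ (x : Fin n → Bool) (b : Bool), h (Function.update x i b) ≠ h x}

namespace BinaryProblem

variable {n m p : ℕ}

/-- The feasible set, as a set of points `(x, y)` of `ℝⁿ × ℝᵖ`. -/
def feasible (I : BinaryProblem n m p) : Set ((Fin n → ℝ) × (Fin p → ℝ)) :=
  {w | ∃ x : Fin n → Bool, w.1 = zeroOneVec x ∧ (∀ i, 0 ≤ I.f i x) ∧ ∀ j, I.g j x = w.2 j}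

/-- The objective function `cᵀx + dᵀy`. -/
noncomputable def objective (I : BinaryProblem n m p) (w : (Fin n → ℝ) × (Fin p → ℝ)) : ℝ :=
  I.c ⬝ᵥ w.1 + I.d ⬝ᵥ w.2

/-- The intersection graph: one vertex for each `x` variable, and an edge between two distinct
variables whenever both appear in a common constraint `f i x ≥ 0` or `g j x = y j`. -/
def intersectionGraph (I : BinaryProblem n m p) : SimpleGraph (Fin n) where
  Adj u v := u ≠ v ∧
    ((∃ i, u ∈ varSupport (I.f i) ∧ v ∈ varSupport (I.f i)) ∨
      (∃ j, u ∈ varSupport (I.g j) ∧ v ∈ varSupport (I.g j)))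
  symm := ⟨fun _ _ h => ⟨h.1.symm, h.2.imp (fun ⟨i, hi⟩ => ⟨i, hi.symm⟩)
    (fun ⟨j, hj⟩ => ⟨j, hj.symm⟩)⟩⟩
  loopless := ⟨fun _ h => h.1 rfl⟩

end BinaryProblem

/-- A tree-decomposition `(T, Q)` of the graph `G`, where `T` has vertex set `τ`. -/
structure TreeDecomposition {V : Type*} (G : SimpleGraph V) (τ : Type*) where
  /-- the tree `T` -/
  tree : SimpleGraph τ
  isTree : tree.IsTree
  /-- the bags `Q t` -/
  bag : τ → Finset V
  /-- For every vertex `v` of `G` the nodes whose bag contains `v` induce a subtree, i.e. a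
  (nonempty) connected subgraph of the tree. -/
  subtree : ∀ v : V, (tree.induce {t | v ∈ bag t}).Connected
  /-- Every edge of `G` is contained in some bag. -/
  edge_subset : ∀ u v : V, G.Adj u v → ∃ t, u ∈ bag t ∧ v ∈ bag t

/-- The width: the largest cardinality of a bag, minus 1. It is an integer, being `-1` when all bags
are empty, which happens only for the graph without vertices. -/
def TreeDecomposition.width {V : Type*} {G : SimpleGraph V} {τ : Type*} [Fintype τ]
    (D : TreeDecomposition G τ) : ℤ :=
  ((Finset.univ.sup fun t => (D.bag t).card : ℕ) : ℤ) - 1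

/-- A linear program `min costᵀz` subject to `A z ≥ b` with `N` real variables and `M` linear
inequality constraints. All constraints on `z`, sign constraints included, are counted in `M`; a
linear equation counts as two inequalities. -/
structure LinearProgram (N M : ℕ) where
  A : Matrix (Fin M) (Fin N) ℝ
  b : Fin M → ℝ
  cost : Fin N → ℝ

namespace LinearProgram

variable {N M : ℕ}

/-- The feasible polyhedron. -/
def feasible (L : LinearProgram N M) : Set (Fin N → ℝ) :=
  {z | ∀ k, L.b k ≤ (L.A.mulVec z) k}

/-- The objective function. -/
noncomputable def objective (L : LinearProgram N M) (z : Fin N → ℝ) : ℝ :=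
  L.cost ⬝ᵥ z

/-- `L` is an exact linear programming reformulation of `I`: a linear map sends the polyhedron of
`L` onto the convex hull of the feasible set of `I`, the objective of `L` is the objective of `I`
composed with this map, and the two problems have the same minimum (one is attained if and only if
the other is). -/
def IsExactReformulation {n m p : ℕ} (L : LinearProgram N M) (I : BinaryProblem n m p) : Prop :=
  ∃ π : (Fin N → ℝ) →ₗ[ℝ] (Fin n → ℝ) × (Fin p → ℝ),
    π '' L.feasible = convexHull ℝ I.feasible ∧
    (∀ z, L.objective z = I.objective (π z)) ∧
    ∀ v : ℝ, IsLeast (I.objective '' I.feasible) v ↔ IsLeast (L.objective '' L.feasible) v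

end LinearProgram

/-! Give each node `t` a probability weight on the subsets of its bag, and require adjacent nodes to
have equal marginals on the intersection of their bags. Because `T` is a tree, such weights glue,
one node at a time, to a probability weight on all subsets of the variables (`exists_joint_weight`,
by `exists_coupling`). The variables of one constraint form a clique, so they lie in a single bag
(`exists_subset_bag`). Hence infeasibility is excluded by killing local weights, and each `x_v` and
`y_j` is the expectation of a function of one bag, that is, linear in the local weights. A joint
weight is then a convex combination of feasible points, and feasible points come from point masses,
so the polytope maps onto the convex hull. -/

/-! ### Separation and the Helly property in tree-decompositions -/

namespace TreeDecomposition

/-- Every edge of the tree is a bridge, so a vertex whose bags meet both sides of an edge `t t'`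
lies in the bag of `t`. -/
theorem mem_bag_of_adj {V τ : Type*} {G : SimpleGraph V} (D : TreeDecomposition G τ)
    {S : Set τ} {r : τ} (hS : ∀ s ∈ S, ∃ q : D.tree.Walk r s, ∀ u ∈ q.support, u ∈ S)
    {t t' : τ} (ht : t ∈ S) (ht' : t' ∉ S) (hadj : D.tree.Adj t t')
    {v : V} (hv : v ∈ D.bag t') {s : τ} (hs : s ∈ S) (hvs : v ∈ D.bag s) : v ∈ D.bag t := by
  by_contra hvt
  have hbr := SimpleGraph.isAcyclic_iff_forall_adj_isBridge.1 D.isTree.isAcyclic hadj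
  obtain ⟨q₁, h₁⟩ := hS t ht
  obtain ⟨q₂, h₂⟩ := hS s hs
  obtain ⟨q₃⟩ := (D.subtree v).preconnected ⟨s, hvs⟩ ⟨t', hv⟩
  let q₄ : D.tree.Walk s t' := q₃.map (SimpleGraph.Embedding.induce {t | v ∈ D.bag t}).toHom
  have h₄ : t ∉ q₄.support := by
    intro h
    have h' : t ∈ (q₃.map (SimpleGraph.Embedding.induce {t | v ∈ D.bag t}).toHom).support := h
    rw [SimpleGraph.Walk.support_map, List.mem_map] at h'
    obtain ⟨⟨u, hu⟩, -, rfl⟩ := h'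
    exact hvt hu
  -- The walk `t → r → s → t'` must use the bridge `tt'`, but its part inside `S` misses `t'` and
  -- its part among the bags containing `v` misses `t`.
  have key := (SimpleGraph.isBridge_iff_forall_walk_mem_edges.1 hbr)
    ((q₁.reverse.append q₂).append q₄)
  rw [SimpleGraph.Walk.edges_append, SimpleGraph.Walk.edges_append,
    SimpleGraph.Walk.edges_reverse, List.mem_append, List.mem_append, List.mem_reverse] at key
  rcases key with (h | h) | h
  · exact ht' (h₁ _ (q₁.snd_mem_support_of_mem_edges h))
  · exact ht' (h₂ _ (q₂.snd_mem_support_of_mem_edges h))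
  · exact h₄ (q₄.fst_mem_support_of_mem_edges h)

/-- Induction over a tree-decomposition: the set of nodes is built from a single node by adding
neighbours `t'` of nodes `t` already present; the bag of `t` separates the bag of `t'` from the
other bags. -/
theorem induction_insert {V τ : Type*} [Fintype τ] [DecidableEq τ] {G : SimpleGraph V}
    (D : TreeDecomposition G τ) {P : Finset τ → Prop} (singleton : ∀ r, P {r})
    (insert : ∀ (S : Finset τ) (t t' : τ), t ∈ S → t' ∉ S → D.tree.Adj t t' →
      (∀ v ∈ D.bag t', ∀ s ∈ S, v ∈ D.bag s → v ∈ D.bag t) → P S → P (insert t' S)) :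
    P Finset.univ := by
  obtain ⟨r⟩ := D.isTree.connected.nonempty
  -- A maximal such `S` is everything: otherwise a walk leaving `S` provides a node to add.
  -- Connectedness inside `S` is kept for the separation property.
  obtain ⟨S, ⟨hrS, hS, hPS⟩, hmax⟩ := (Set.toFinite {S : Finset τ | r ∈ S ∧
    (∀ s ∈ S, ∃ q : D.tree.Walk r s, ∀ u ∈ q.support, u ∈ S) ∧ P S}).exists_maximal
    ⟨{r}, by simp, fun s hs => by
      obtain rfl := Finset.mem_singleton.1 hs
      exact ⟨.nil, by simp⟩, singleton r⟩
  by_cases hu : S = Finset.univ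
  · exact hu ▸ hPS
  exfalso
  obtain ⟨w, hw⟩ : ∃ w, w ∉ S := by
    by_contra! h
    exact hu (Finset.eq_univ_of_forall h)
  obtain ⟨q⟩ := D.isTree.connected.preconnected r w
  obtain ⟨d, -, ht, ht'⟩ := q.exists_boundary_dart (S : Set τ) hrS hw
  have hle := hmax (y := Insert.insert d.snd S) ⟨Finset.mem_insert_of_mem hrS, ?_, ?_⟩
    (Finset.subset_insert _ _)
  · exact ht' (hle (Finset.mem_insert_self _ _))
  · intro s hs
    rcases Finset.mem_insert.1 hs with rfl | hs
    · obtain ⟨q', hq'⟩ := hS _ ht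
      refine ⟨q'.concat d.adj, fun u hu => ?_⟩
      rw [SimpleGraph.Walk.support_concat, List.mem_append] at hu
      rcases hu with hu | hu
      · exact Finset.mem_insert_of_mem (hq' u hu)
      · rw [List.mem_singleton.1 hu]
        exact Finset.mem_insert_self _ _
    · obtain ⟨q', hq'⟩ := hS s hs
      exact ⟨q', fun u hu => Finset.mem_insert_of_mem (hq' u hu)⟩
  · exact insert S d.fst d.snd ht ht' d.adj
      (fun v hv s hs hvs => D.mem_bag_of_adj (S := (S : Set τ)) hS ht ht' d.adj hv hs hvs) hPS

/-- Helly property: a set of vertices is contained in a bag if any two of its elements are. -/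
theorem exists_subset_bag {V τ : Type*} [Fintype τ] {G : SimpleGraph V}
    (D : TreeDecomposition G τ) (K : Set V)
    (hK : ∀ u ∈ K, ∀ v ∈ K, ∃ t, u ∈ D.bag t ∧ v ∈ D.bag t) : ∃ t, K ⊆ D.bag t := by
  classical
  suffices h : (∀ u ∈ K, ∀ v ∈ K, ∃ t ∈ Finset.univ, u ∈ D.bag t ∧ v ∈ D.bag t) →
      ∃ t ∈ Finset.univ, K ⊆ D.bag t by simpa using h (by simpa using hK)
  refine D.induction_insert (P := fun S => (∀ u ∈ K, ∀ v ∈ K, ∃ t ∈ S, u ∈ D.bag t ∧ v ∈ D.bag t) →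
      ∃ t ∈ S, K ⊆ D.bag t) (fun r h => ?_) (fun S t t' ht _ _ hsep IH h => ?_)
  · refine ⟨r, by simp, fun u hu => ?_⟩
    obtain ⟨t, ht, hut, -⟩ := h u hu u hu
    rwa [Finset.mem_singleton.1 ht] at hut
  · by_cases hKt' : K ⊆ D.bag t'
    · exact ⟨t', by simp, hKt'⟩
    obtain ⟨u, huK, hut'⟩ := Set.not_subset.1 hKt'
    -- A bag shared by `u` and `v` is not that of `t'`, so it belongs to `S`, and separation
    -- applies. Thus `t` can replace `t'`.
    have hmem : ∀ v ∈ K, v ∈ D.bag t' → v ∈ D.bag t := fun v hv hvt' => by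
      obtain ⟨s, hs, hus, hvs⟩ := h u huK v hv
      rcases Finset.mem_insert.1 hs with rfl | hs
      · exact absurd hus hut'
      · exact hsep v hvt' s hs hvs
    obtain ⟨s, hs, hKs⟩ := IH fun v hv w hw => by
      obtain ⟨s, hs, hvs, hws⟩ := h v hv w hw
      rcases Finset.mem_insert.1 hs with rfl | hs
      · exact ⟨t, ht, hmem v hv hvs, hmem w hw hws⟩
      · exact ⟨s, hs, hvs, hws⟩
    exact ⟨s, Finset.mem_insert_of_mem hs, hKs⟩

end TreeDecomposition

/-! ### Gluing weights along the tree -/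

/-- Integration against the image `ν` of a weight `μ` under a map `p`. -/
theorem sum_mul_of_fiberwise {X A : Type*} [Fintype X] [Fintype A] [DecidableEq A]
    (p : X → A) (μ : X → ℝ) (ν : A → ℝ) (h : ∀ a, ∑ x with p x = a, μ x = ν a) (φ : A → ℝ) :
    ∑ a, φ a * ν a = ∑ x, φ (p x) * μ x := by
  rw [← Finset.sum_fiberwise Finset.univ p]
  refine Finset.sum_congr rfl fun a _ => ?_
  rw [← h, Finset.mul_sum]
  refine Finset.sum_congr rfl fun x hx => ?_
  rw [(Finset.mem_filter.1 hx).2]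

/-- Two weights with the same image under maps to a common set have a coupling supported on the
fibre product. -/
theorem exists_coupling {X A Z : Type*} [Fintype X] [Fintype A] [DecidableEq Z]
    (p : X → Z) (q : A → Z) (μ : X → ℝ) (ν : A → ℝ) (hμ : ∀ x, 0 ≤ μ x) (hν : ∀ a, 0 ≤ ν a)
    (h : ∀ z, ∑ x with p x = z, μ x = ∑ a with q a = z, ν a) :
    ∃ w : X → A → ℝ, (∀ x a, 0 ≤ w x a) ∧ (∀ x a, w x a ≠ 0 → p x = q a) ∧
      (∀ x, ∑ a, w x a = μ x) ∧ ∀ a, ∑ x, w x a = ν a := by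
  have hσ : ∀ z, 0 ≤ ∑ x with p x = z, μ x := fun z => Finset.sum_nonneg fun x _ => hμ x
  -- The coupling that is independent conditionally on the common image. On a fibre of mass `0` all
  -- weights vanish, so division by zero is harmless.
  refine ⟨fun x a => if p x = q a then μ x * ν a / ∑ x with p x = q a, μ x else 0,
    fun x a => ?_, fun x a hxa => ?_, fun x => ?_, fun a => ?_⟩
  · dsimp only
    split_ifs
    · exact div_nonneg (mul_nonneg (hμ x) (hν a)) (hσ _)
    · exact le_rfl
  · by_contra hne
    simp [hne] at hxa
  · have e : ∀ a, (if p x = q a then μ x * ν a / ∑ x with p x = q a, μ x else 0) =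
        μ x / (∑ x' with p x' = p x, μ x') * if q a = p x then ν a else 0 := fun a => by
      by_cases hxa : p x = q a
      · simp only [hxa, if_true]; ring
      · simp [hxa, Ne.symm hxa]
    rw [Finset.sum_congr rfl fun a _ => e a, ← Finset.mul_sum, ← Finset.sum_filter, ← h]
    by_cases h0 : ∑ x' with p x' = p x, μ x' = 0
    · rw [h0, mul_zero, eq_comm]
      exact (Finset.sum_eq_zero_iff_of_nonneg fun x _ => hμ x).1 h0 x (by simp)
    · exact div_mul_cancel₀ _ h0
  · have e : ∀ x, (if p x = q a then μ x * ν a / ∑ x with p x = q a, μ x else 0) =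
        ν a / (∑ x' with p x' = q a, μ x') * if p x = q a then μ x else 0 := fun x => by
      split_ifs
      · ring
      · simp
    rw [Finset.sum_congr rfl fun x _ => e x, ← Finset.mul_sum, ← Finset.sum_filter]
    by_cases h0 : ∑ x' with p x' = q a, μ x' = 0
    · rw [h0, mul_zero, eq_comm]
      rw [h] at h0
      exact (Finset.sum_eq_zero_iff_of_nonneg fun a _ => hν a).1 h0 a (by simp)
    · exact div_mul_cancel₀ _ h0

/-- Locally consistent weights on the subsets of the bags of a tree-decomposition are the marginals
of a weight on the subsets of the vertex set. -/
theorem TreeDecomposition.exists_joint_weight {V τ : Type*} [Fintype V] [DecidableEq V] [Fintype τ]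
    {G : SimpleGraph V} (D : TreeDecomposition G τ) (ν : τ → Finset V → ℝ)
    (hν : ∀ t a, 0 ≤ ν t a) (hsupp : ∀ t a, ν t a ≠ 0 → a ⊆ D.bag t)
    (hcons : ∀ t t', D.tree.Adj t t' → ∀ s,
      ∑ a with a ∩ (D.bag t ∩ D.bag t') = s, ν t a =
        ∑ a with a ∩ (D.bag t ∩ D.bag t') = s, ν t' a) :
    ∃ μ : Finset V → ℝ, (∀ x, 0 ≤ μ x) ∧
      ∀ t a, ∑ x with x ∩ D.bag t = a, μ x = ν t a := by
  classical
  suffices h : ∃ μ : Finset V → ℝ, (∀ x, 0 ≤ μ x) ∧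
      ∀ t ∈ Finset.univ, ∀ a, ∑ x with x ∩ D.bag t = a, μ x = ν t a by simpa using h
  refine D.induction_insert (P := fun S => ∃ μ : Finset V → ℝ, (∀ x, 0 ≤ μ x) ∧
      ∀ t ∈ S, ∀ a, ∑ x with x ∩ D.bag t = a, μ x = ν t a) (fun r => ?_)
      (fun S t t' ht _ hadj hsep IH => ?_)
  · refine ⟨ν r, hν r, fun t ht a => ?_⟩
    obtain rfl := Finset.mem_singleton.1 ht
    rw [Finset.sum_filter]
    have e : ∀ x, (if x ∩ D.bag t = a then ν t x else 0) = if x = a then ν t x else 0 := fun x => by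
      by_cases hx : ν t x = 0
      · simp [hx]
      · rw [Finset.inter_eq_left.2 (hsupp t x hx)]
    simp [e]
  · obtain ⟨μ, hμ, hmarg⟩ := IH
    set R := D.bag t ∩ D.bag t' with hR
    obtain ⟨w, hw, hwR, hw₁, hw₂⟩ := exists_coupling (fun x => x ∩ R) (fun a => a ∩ R) μ (ν t') hμ
      (hν t') fun s => by
        rw [← hcons t t' hadj s]
        have h₁ := sum_mul_of_fiberwise (fun x => x ∩ D.bag t) μ (ν t) (hmarg t ht)
          fun a => if a ∩ R = s then 1 else 0
        have h₂ : ∀ x, x ∩ D.bag t ∩ R = x ∩ R := fun x => by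
          rw [hR]; ext v; simp
        simpa [h₂, Finset.sum_filter] using h₁.symm
    have key : ∀ (B : Finset V) (b : Finset V),
        ∑ x' with x' ∩ B = b, ∑ x, ∑ a, (if x \ D.bag t' ∪ a = x' then w x a else 0) =
          ∑ x, ∑ a, if (x \ D.bag t' ∪ a) ∩ B = b then w x a else 0 := fun B b => by
      rw [Finset.sum_comm]
      refine Finset.sum_congr rfl fun x _ => ?_
      rw [Finset.sum_comm]
      refine Finset.sum_congr rfl fun a _ => ?_
      rw [Finset.sum_ite_eq]
      simp
    -- The image of the coupling under overwriting `x` by `a` on the new bag.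
    refine ⟨fun x' => ∑ x, ∑ a, if x \ D.bag t' ∪ a = x' then w x a else 0, fun x' => ?_,
      fun s hs b => ?_⟩
    · refine Finset.sum_nonneg fun x _ => Finset.sum_nonneg fun a _ => ?_
      split_ifs
      exacts [hw x a, le_rfl]
    rw [key]
    have hwsub : ∀ x a, w x a ≠ 0 → a ⊆ D.bag t' := fun x a h => hsupp t' a fun h0 => h <| by
      rw [← hw₂] at h0
      exact (Finset.sum_eq_zero_iff_of_nonneg fun x _ => hw x a).1 h0 x (by simp)
    have hov : ∀ x a, w x a ≠ 0 → (x \ D.bag t' ∪ a) ∩ D.bag t' = a := fun x a h => by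
      ext v
      have h₁ := @hwsub x a h v
      simp only [Finset.mem_inter, Finset.mem_union, Finset.mem_sdiff]
      tauto
    rcases Finset.mem_insert.1 hs with rfl | hs
    · rw [Finset.sum_comm, ← hw₂, Finset.sum_eq_single b]
      · refine Finset.sum_congr rfl fun x _ => ?_
        by_cases hxb : w x b = 0
        · simp [hxb]
        · rw [hov x b hxb, if_pos rfl]
      · intro a _ hab
        refine Finset.sum_eq_zero fun x _ => ?_
        by_cases hxa : w x a = 0
        · simp [hxa]
        · rw [hov x a hxa, if_neg hab]
      · simp
    · rw [← hmarg s hs, Finset.sum_filter]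
      refine Finset.sum_congr rfl fun x _ => ?_
      have e : ∀ a, (if (x \ D.bag t' ∪ a) ∩ D.bag s = b then w x a else 0) =
          if x ∩ D.bag s = b then w x a else 0 := fun a => by
        by_cases hxa : w x a = 0
        · simp [hxa]
        have h₁ := hwsub x a hxa
        have h₂ : ∀ v, v ∈ x ∩ R ↔ v ∈ a ∩ R := fun v => by rw [hwR x a hxa]
        -- Overwriting is invisible in old bags: they meet the new bag only inside `R`, where `x`
        -- and `a` agree.
        have : (x \ D.bag t' ∪ a) ∩ D.bag s = x ∩ D.bag s := by
          ext v
          have h₃ := h₂ v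
          have h₄ := @h₁ v
          have h₅ := fun hv => hsep v hv s hs
          simp only [hR, Finset.mem_inter, Finset.mem_union, Finset.mem_sdiff] at h₃ ⊢
          tauto
        rw [this]
      rw [Finset.sum_congr rfl fun a _ => e a, ← hw₁]
      split_ifs <;> simp

/-! ### Convex hulls, linear programs and supports -/

/-- A linear function attains the same minimum on a set and on its convex hull. -/
theorem isLeast_image_convexHull_iff {E : Type*} [AddCommGroup E] [Module ℝ E] (h : E →ₗ[ℝ] ℝ)
    (F : Set E) (v : ℝ) : IsLeast (h '' F) v ↔ IsLeast (h '' convexHull ℝ F) v := by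
  constructor
  · rintro ⟨hv, hlb⟩
    refine ⟨Set.image_mono (subset_convexHull ℝ F) hv, ?_⟩
    rintro _ ⟨w, hw, rfl⟩
    exact convexHull_min (fun w hw => hlb ⟨w, hw, rfl⟩) (convex_halfSpace_ge h.isLinear v) hw
  · rintro ⟨⟨w, hw, rfl⟩, hlb⟩
    have hlb' : ∀ u ∈ F, h w ≤ h u := fun u hu => hlb ⟨u, subset_convexHull ℝ F hu, rfl⟩
    refine ⟨?_, ?_⟩
    · by_contra hne
      -- If no point of `F` attained the minimum, `F` and hence its hull would lie in an open
      -- half-space that excludes `w`.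
      have : w ∈ {u | h w < h u} := convexHull_min
        (fun u hu => lt_of_le_of_ne (hlb' u hu) fun e => hne ⟨u, hu, e.symm⟩)
        (convex_halfSpace_gt h.isLinear _) hw
      exact lt_irrefl (h w) this
    · rintro _ ⟨u, hu, rfl⟩
      exact hlb' u hu

/-- The objective function of a binary problem as a linear map. -/
theorem BinaryProblem.exists_linearMap_objective {n m p : ℕ} (I : BinaryProblem n m p) :
    ∃ h : ((Fin n → ℝ) × (Fin p → ℝ)) →ₗ[ℝ] ℝ, ∀ w, h w = I.objective w :=
  ⟨⟨⟨I.objective, fun a b => by simp [BinaryProblem.objective, dotProduct_add]; ring⟩,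
    fun r a => by simp [BinaryProblem.objective, dotProduct_smul]; ring⟩, fun _ => rfl⟩

/-- A polyhedron given by linear inequalities in arbitrarily indexed variables, with a linear map
onto the convex hull of the feasible set, yields an exact reformulation. -/
theorem BinaryProblem.exists_isExactReformulation {n m p M : ℕ} (I : BinaryProblem n m p)
    {ι : Type*} [Fintype ι] (A : Fin M → (ι → ℝ) →ₗ[ℝ] ℝ) (b : Fin M → ℝ)
    (π : (ι → ℝ) →ₗ[ℝ] (Fin n → ℝ) × (Fin p → ℝ))
    (hπ : π '' {z | ∀ k, b k ≤ A k z} = convexHull ℝ I.feasible) :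
    ∃ L : LinearProgram (Fintype.card ι) M, L.IsExactReformulation I := by
  classical
  obtain ⟨h, hh⟩ := I.exists_linearMap_objective
  let e : (Fin (Fintype.card ι) → ℝ) ≃ₗ[ℝ] (ι → ℝ) :=
    LinearEquiv.funCongrLeft ℝ ℝ (Fintype.equivFin ι)
  let π' := π ∘ₗ e.toLinearMap
  let L : LinearProgram (Fintype.card ι) M :=
    { A := LinearMap.toMatrix' (LinearMap.pi fun k => A k ∘ₗ e.toLinearMap)
      b := b
      cost := fun i => h (π' fun j => if i = j then 1 else 0) }
  have hobj : ∀ z, L.objective z = I.objective (π' z) := fun z => by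
    rw [← hh, ← LinearMap.comp_apply, LinearMap.pi_apply_eq_sum_univ]
    simp [LinearProgram.objective, L, dotProduct, mul_comm]
  have himg : π' '' L.feasible = convexHull ℝ I.feasible := by
    rw [← hπ]
    have : L.feasible = e ⁻¹' {z | ∀ k, b k ≤ A k z} := by
      ext z
      simp only [LinearProgram.feasible, L, Set.mem_ofPred_eq, Set.mem_preimage]
      rw [LinearMap.toMatrix'_mulVec]
      rfl
    rw [this, LinearMap.coe_comp, Set.image_comp]
    exact congrArg _ (Set.image_preimage_eq _ e.surjective)
  refine ⟨L, π', himg, hobj, fun v => ?_⟩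
  have h₁ : L.objective '' L.feasible = h '' convexHull ℝ I.feasible := by
    rw [← himg, Set.image_image]
    exact Set.image_congr fun z _ => by rw [hobj, hh]
  have h₂ : I.objective '' I.feasible = h '' I.feasible :=
    Set.image_congr fun w _ => (hh w).symm
  rw [h₁, h₂, isLeast_image_convexHull_iff]

/-- A function on Boolean vectors depends only on the coordinates in its support. -/
theorem eq_of_eqOn_varSupport {n : ℕ} (h : (Fin n → Bool) → ℝ) (x y : Fin n → Bool)
    (hxy : ∀ i ∈ varSupport h, x i = y i) : h x = h y := by
  -- Change `x` into `y` one coordinate at a time.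
  suffices H : ∀ s : Finset (Fin n), h (s.piecewise y x) = h x by
    simpa using (H Finset.univ).symm
  intro s
  induction s using Finset.induction_on with
  | empty => simp
  | insert i s hi IH =>
    rw [← IH, Finset.piecewise_insert]
    by_cases hs : i ∈ varSupport h
    · rw [← hxy i hs]
      congr 1
      refine Function.update_eq_self_iff.2 ?_
      simp [hi]
    · by_contra hne
      exact hs ⟨_, _, hne⟩

/-! ### The polytope of locally consistent weights -/

namespace TreeDecomposition

variable {V τ : Type*} {G : SimpleGraph V} (D : TreeDecomposition G τ)

/-- The pairs `(t, a)` where `a` is a subset of the bag of `t`. -/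
abbrev LocalIndex : Type _ := Σ t, (D.bag t).powerset

theorem card_localIndex_le [Fintype τ] {W : ℕ} (hW : ∀ t, (D.bag t).card ≤ W) :
    Fintype.card D.LocalIndex ≤ Fintype.card τ * 2 ^ W := by
  rw [Fintype.card_sigma, ← smul_eq_mul]
  refine Finset.sum_le_card_nsmul _ _ _ fun t _ => ?_
  rw [Fintype.card_coe, Finset.card_powerset]
  exact Nat.pow_le_pow_right two_pos (hW t)

variable [DecidableEq V]

/-- The coordinate of a vector of local weights at `(t, a)`, which is `0` if `a` is not a subset of
the bag of `t`. -/
noncomputable def localWeight (t : τ) (a : Finset V) : (D.LocalIndex → ℝ) →ₗ[ℝ] ℝ :=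
  if h : a ∈ (D.bag t).powerset then LinearMap.proj ⟨t, a, h⟩ else 0

/-- The local weights are probability weights, which avoid the forbidden pairs `bad` and have equal
marginals on the intersection of two adjacent bags. -/
structure IsLocallyConsistent [Fintype V] (bad : τ → Finset V → Prop) (z : D.LocalIndex → ℝ) :
    Prop where
  nonneg : ∀ t a, 0 ≤ D.localWeight t a z
  nonpos_of_bad : ∀ t a, bad t a → D.localWeight t a z ≤ 0
  sum_eq_one : ∀ t, ∑ a, D.localWeight t a z = 1
  marginal_eq : ∀ t t', D.tree.Adj t t' → ∀ s,
    ∑ a with a ∩ (D.bag t ∩ D.bag t') = s, D.localWeight t a z =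
      ∑ a with a ∩ (D.bag t ∩ D.bag t') = s, D.localWeight t' a z

theorem localWeight_mk (t : τ) (a : (D.bag t).powerset) (z : D.LocalIndex → ℝ) :
    D.localWeight t a z = z ⟨t, a⟩ := by
  simp only [localWeight, Finset.coe_mem, dif_pos, LinearMap.proj_apply]

theorem localWeight_of_not_subset {t : τ} {a : Finset V} (h : ¬ a ⊆ D.bag t)
    (z : D.LocalIndex → ℝ) : D.localWeight t a z = 0 := by
  rw [localWeight, dif_neg (by simpa using h), LinearMap.zero_apply]

theorem forall_localWeight {P : τ → Finset V → ℝ → Prop} (hP : ∀ t a, P t a 0)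
    (z : D.LocalIndex → ℝ) :
    (∀ t a, P t a (D.localWeight t a z)) ↔ ∀ i : D.LocalIndex, P i.1 i.2 (z i) := by
  refine ⟨fun h i => D.localWeight_mk i.1 i.2 z ▸ h i.1 i.2, fun h t a => ?_⟩
  by_cases ha : a ⊆ D.bag t
  · exact (D.localWeight_mk t ⟨a, Finset.mem_powerset.2 ha⟩ z).symm ▸
      h ⟨t, a, Finset.mem_powerset.2 ha⟩
  · rw [D.localWeight_of_not_subset ha]
    exact hP t a

/-- Local consistency is described by linear inequalities, whose number is linear in the number of
nodes. -/
theorem exists_linear_inequalities [Fintype τ] [Fintype V] {W : ℕ} (hW : ∀ t, (D.bag t).card ≤ W)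
    (bad : τ → Finset V → Prop) :
    ∃ (M : ℕ) (A : Fin M → (D.LocalIndex → ℝ) →ₗ[ℝ] ℝ) (b : Fin M → ℝ),
      M ≤ 6 * (Fintype.card τ * 2 ^ W) ∧
      ∀ z, (∀ k, b k ≤ A k z) ↔ D.IsLocallyConsistent bad z := by
  classical
  let S : D.tree.Dart → Finset V := fun d => D.bag d.fst ∩ D.bag d.snd
  -- Signs, forbidden pairs, total mass as two inequalities, marginals. The two orientations of an
  -- edge give the two halves of a marginal equation. Each of the three groups has at most `2 *
  -- (card τ * 2 ^ W)` members.
  let κ := (D.LocalIndex ⊕ D.LocalIndex) ⊕ (τ ⊕ τ) ⊕ Σ d : D.tree.Dart, (S d).powerset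
  let A : κ → (D.LocalIndex → ℝ) →ₗ[ℝ] ℝ := Sum.elim
    (Sum.elim (fun i => LinearMap.proj i)
      (fun i => if bad i.1 i.2 then -LinearMap.proj i else 0))
    (Sum.elim (Sum.elim (fun t => ∑ a, D.localWeight t a) (fun t => -∑ a, D.localWeight t a))
      (fun r => ∑ a with a ∩ S r.1 = r.2, D.localWeight r.1.fst a -
        ∑ a with a ∩ S r.1 = r.2, D.localWeight r.1.snd a))
  let b : κ → ℝ := Sum.elim 0 (Sum.elim (Sum.elim 1 (-1)) 0)
  refine ⟨Fintype.card κ, A ∘ (Fintype.equivFin κ).symm, b ∘ (Fintype.equivFin κ).symm, ?_,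
    fun z => ?_⟩
  · have h₁ := D.card_localIndex_le hW
    have h₂ : Fintype.card (Σ d : D.tree.Dart, (S d).powerset) ≤
        2 * (Fintype.card τ * 2 ^ W) := by
      have hcard : Fintype.card D.tree.Dart ≤ 2 * Fintype.card τ := by
        rw [SimpleGraph.dart_card_eq_twice_card_edges, ← D.isTree.card_edgeFinset]
        omega
      rw [Fintype.card_sigma, ← mul_assoc]
      refine le_trans (Finset.sum_le_card_nsmul _ _ (2 ^ W) fun d _ => ?_)
        (Nat.mul_le_mul_right _ hcard)
      rw [Fintype.card_coe, Finset.card_powerset]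
      exact Nat.pow_le_pow_right two_pos
        ((Finset.card_le_card Finset.inter_subset_left).trans (hW d.fst))
    have h₃ : Fintype.card τ ≤ Fintype.card τ * 2 ^ W :=
      Nat.le_mul_of_pos_right _ (by positivity)
    simp only [κ, Fintype.card_sum]
    omega
  · refine ((Fintype.equivFin κ).symm.forall_congr_right (q := fun k => b k ≤ A k z)).trans
      ⟨fun H => ⟨?_, ?_, fun t => ?_, fun t t' hadj s => ?_⟩, fun H => ?_⟩
    · exact (D.forall_localWeight (P := fun _ _ r => 0 ≤ r) (fun _ _ => le_rfl) z).2
        fun i => H (.inl (.inl i))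
    · refine (D.forall_localWeight (P := fun t a r => bad t a → r ≤ 0)
        (fun _ _ _ => le_rfl) z).2 fun i hi => ?_
      have := H (.inl (.inr i))
      simpa [A, b, hi] using this
    · have h₁ := H (.inr (.inl (.inl t)))
      have h₂ := H (.inr (.inl (.inr t)))
      simp only [A, b, Sum.elim_inl, Sum.elim_inr, Pi.one_apply, Pi.neg_apply,
        LinearMap.neg_apply, LinearMap.sum_apply] at h₁ h₂
      linarith
    · by_cases hs : s ⊆ D.bag t ∩ D.bag t'
      · have h₁ := H (.inr (.inr ⟨⟨(t, t'), hadj⟩, s, Finset.mem_powerset.2 hs⟩))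
        have h₂ := H (.inr (.inr ⟨⟨(t', t), hadj.symm⟩, s,
          Finset.mem_powerset.2 (hs.trans (Finset.inter_comm _ _).subset)⟩))
        simp only [A, b, S, Sum.elim_inr, Pi.zero_apply,
          LinearMap.sub_apply, LinearMap.sum_apply] at h₁ h₂
        rw [Finset.inter_comm (D.bag t')] at h₂
        linarith
      · rw [Finset.filter_false_of_mem, Finset.sum_empty, Finset.sum_empty]
        rintro a - rfl
        exact hs Finset.inter_subset_right
    · rintro ((i | i) | (t | t) | ⟨d, s, -⟩)
      · exact (D.forall_localWeight (P := fun _ _ r => 0 ≤ r) (fun _ _ => le_rfl) z).1 H.nonneg i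
      · have := (D.forall_localWeight (P := fun t a r => bad t a → r ≤ 0)
          (fun _ _ _ => le_rfl) z).1 H.nonpos_of_bad i
        by_cases hi : bad i.1 i.2
        · simpa [A, b, hi] using this hi
        · simp [A, b, hi]
      · simp [A, b, H.sum_eq_one t]
      · simp [A, b, H.sum_eq_one t]
      · simp [A, b, S, H.marginal_eq _ _ d.adj s]

/-- The marginals of a point mass on the subsets of the vertex set are locally consistent. -/
theorem exists_isLocallyConsistent_of_point [Fintype V] (bad : τ → Finset V → Prop) (x : Finset V)
    (hx : ∀ t, ¬ bad t (x ∩ D.bag t)) :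
    ∃ z, D.IsLocallyConsistent bad z ∧
      ∀ t a, D.localWeight t a z = if a = x ∩ D.bag t then 1 else 0 := by
  let z : D.LocalIndex → ℝ := fun i => if (i.2 : Finset V) = x ∩ D.bag i.1 then 1 else 0
  have hz : ∀ t a, D.localWeight t a z = if a = x ∩ D.bag t then 1 else 0 := fun t a => by
    by_cases ha : a ⊆ D.bag t
    · exact D.localWeight_mk t ⟨a, Finset.mem_powerset.2 ha⟩ z
    · rw [D.localWeight_of_not_subset ha, if_neg]
      rintro rfl
      exact ha Finset.inter_subset_right
  refine ⟨z, ⟨fun t a => ?_, fun t a hb => ?_, fun t => ?_, fun t t' _ s => ?_⟩, hz⟩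
  · rw [hz]
    split_ifs <;> norm_num
  · rw [hz, if_neg]
    rintro rfl
    exact hx t hb
  · simp [hz]
  · have h₁ : x ∩ D.bag t ∩ (D.bag t ∩ D.bag t') = x ∩ D.bag t' ∩ (D.bag t ∩ D.bag t') := by
      ext v
      simp only [Finset.mem_inter]
      tauto
    simp [hz, Finset.sum_ite_eq', Finset.mem_filter, h₁]

/-- Locally consistent weights are the marginals of a probability weight on the subsets of the
vertex set, which avoids the forbidden pairs. -/
theorem IsLocallyConsistent.exists_joint_weight [Fintype τ] [Fintype V] {bad : τ → Finset V → Prop}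
    {z : D.LocalIndex → ℝ} (hz : D.IsLocallyConsistent bad z) :
    ∃ μ : Finset V → ℝ, (∀ x, 0 ≤ μ x) ∧ ∑ x, μ x = 1 ∧
      (∀ x, μ x ≠ 0 → ∀ t, ¬ bad t (x ∩ D.bag t)) ∧
      ∀ t (φ : Finset V → ℝ),
        ∑ a, φ a * D.localWeight t a z = ∑ x, φ (x ∩ D.bag t) * μ x := by
  obtain ⟨μ, hμ, hmarg⟩ := D.exists_joint_weight (fun t a => D.localWeight t a z) hz.nonneg
    (fun t a h => not_not.1 fun ha => h (D.localWeight_of_not_subset ha z)) hz.marginal_eq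
  have hφ := fun t => sum_mul_of_fiberwise (fun x => x ∩ D.bag t) μ _ (hmarg t)
  refine ⟨μ, hμ, ?_, fun x hx t hb => hx ?_, hφ⟩
  · obtain ⟨t⟩ := D.isTree.connected.nonempty
    simpa [hz.sum_eq_one t] using (hφ t fun _ => 1).symm
  · have h₁ := hz.nonpos_of_bad t _ hb
    rw [← hmarg] at h₁
    exact (Finset.sum_eq_zero_iff_of_nonneg fun x _ => hμ x).1
      (h₁.antisymm (Finset.sum_nonneg fun x _ => hμ x)) x (by simp)

end TreeDecomposition

/-! ### Projection onto the convex hull of the feasible set -/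

/-- The Boolean vector of a set of coordinates. -/
def boolVec {n : ℕ} (a : Finset (Fin n)) : Fin n → Bool := fun i => decide (i ∈ a)

theorem boolVec_surjective {n : ℕ} : Function.Surjective (boolVec (n := n)) := fun x =>
  ⟨Finset.univ.filter fun i => x i, by ext i; simp [boolVec]⟩

theorem zeroOneVec_injective {n : ℕ} : Function.Injective (zeroOneVec (n := n)) :=
  fun x y h => by
    ext i
    have := congrFun h i
    by_cases hx : x i <;> by_cases hy : y i <;> simp_all [zeroOneVec]

theorem apply_boolVec_inter {n : ℕ} (h : (Fin n → Bool) → ℝ) (x Q : Finset (Fin n))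
    (hQ : varSupport h ⊆ Q) : h (boolVec (x ∩ Q)) = h (boolVec x) :=
  eq_of_eqOn_varSupport h _ _ fun i hi => by
    have : i ∈ Q := hQ hi
    simp [boolVec, this]

theorem BinaryProblem.exists_varSupport_subset_bag {n m p : ℕ} (I : BinaryProblem n m p)
    {τ : Type*} [Fintype τ] (D : TreeDecomposition I.intersectionGraph τ)
    (h : (Fin n → Bool) → ℝ) (hh : (∃ i, h = I.f i) ∨ ∃ j, h = I.g j) :
    ∃ t, varSupport h ⊆ D.bag t := by
  refine D.exists_subset_bag _ fun u hu v hv => ?_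
  by_cases huv : u = v
  · obtain ⟨t, ht⟩ := (D.subtree u).nonempty
    exact ⟨t, ht, huv ▸ ht⟩
  · refine D.edge_subset u v ⟨huv, ?_⟩
    rcases hh with ⟨i, rfl⟩ | ⟨j, rfl⟩
    · exact .inl ⟨i, hu, hv⟩
    · exact .inr ⟨j, hu, hv⟩

/-- The convex hull of the feasible set is a linear image of the polytope of locally consistent
weights. -/
theorem BinaryProblem.exists_image_isLocallyConsistent_eq {n m p : ℕ} (I : BinaryProblem n m p)
    {τ : Type*} [Fintype τ] (D : TreeDecomposition I.intersectionGraph τ) :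
    ∃ (bad : τ → Finset (Fin n) → Prop)
      (π : (D.LocalIndex → ℝ) →ₗ[ℝ] (Fin n → ℝ) × (Fin p → ℝ)),
      Convex ℝ {z | D.IsLocallyConsistent bad z} →
        π '' {z | D.IsLocallyConsistent bad z} = convexHull ℝ I.feasible := by
  have hv : ∀ v, ∃ t, v ∈ D.bag t := fun v =>
    let ⟨⟨t, ht⟩⟩ := (D.subtree v).nonempty
    ⟨t, ht⟩
  choose tv htv using hv
  choose tf htf using fun i => I.exists_varSupport_subset_bag D (I.f i) (.inl ⟨i, rfl⟩)
  choose tg htg using fun j => I.exists_varSupport_subset_bag D (I.g j) (.inr ⟨j, rfl⟩)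
  -- Each constraint is tested only at one chosen node whose bag contains its support.
  let bad : τ → Finset (Fin n) → Prop := fun t a => ∃ i, tf i = t ∧ I.f i (boolVec a) < 0
  let π : (D.LocalIndex → ℝ) →ₗ[ℝ] (Fin n → ℝ) × (Fin p → ℝ) := LinearMap.prod
    (LinearMap.pi fun v => ∑ a, zeroOneVec (boolVec a) v • D.localWeight (tv v) a)
    (LinearMap.pi fun j => ∑ a, I.g j (boolVec a) • D.localWeight (tg j) a)
  let pt : Finset (Fin n) → (Fin n → ℝ) × (Fin p → ℝ) := fun x =>
    (zeroOneVec (boolVec x), fun j => I.g j (boolVec x))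
  have hπ : ∀ (μ : Finset (Fin n) → ℝ) (z : D.LocalIndex → ℝ), (∀ t (φ : Finset (Fin n) → ℝ),
      ∑ a, φ a * D.localWeight t a z = ∑ x, φ (x ∩ D.bag t) * μ x) →
      π z = ∑ x, μ x • pt x := fun μ z h => by
    refine Prod.ext (funext fun v => ?_) (funext fun j => ?_)
    · have h₁ := h (tv v) fun a => zeroOneVec (boolVec a) v
      have h₂ : ∀ x, zeroOneVec (boolVec (x ∩ D.bag (tv v))) v = zeroOneVec (boolVec x) v :=
        fun x => by
          have : v ∈ D.bag (tv v) := htv v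
          simp [zeroOneVec, boolVec, this]
      simp only [h₂] at h₁
      simpa [π, pt, Prod.fst_sum, mul_comm] using h₁
    · have h₁ := h (tg j) fun a => I.g j (boolVec a)
      simp only [apply_boolVec_inter _ _ _ (htg j)] at h₁
      simpa [π, pt, Prod.snd_sum, mul_comm] using h₁
  have hfeas : ∀ x, pt x ∈ I.feasible ↔ ∀ t, ¬ bad t (x ∩ D.bag t) := fun x => by
    constructor
    · rintro ⟨x', hx', hf, -⟩ t ⟨i, rfl, hi⟩
      obtain rfl : boolVec x = x' := zeroOneVec_injective hx'
      rw [apply_boolVec_inter _ _ _ (htf i)] at hi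
      exact absurd (hf i) (not_le.2 hi)
    · intro h
      refine ⟨boolVec x, rfl, fun i => not_lt.1 fun hi => h (tf i) ⟨i, rfl, ?_⟩, fun _ => rfl⟩
      rwa [apply_boolVec_inter _ _ _ (htf i)]
  refine ⟨bad, π, fun hconv => Set.Subset.antisymm ?_ (convexHull_min ?_ (hconv.linear_image π))⟩
  · rintro _ ⟨z, hz, rfl⟩
    obtain ⟨μ, hμ, hsum, hbad, hmarg⟩ :=
      TreeDecomposition.IsLocallyConsistent.exists_joint_weight D hz
    -- Terms of weight `0` are dropped, since their points may be infeasible.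
    rw [hπ μ z hmarg, ← Finset.sum_filter_of_ne (p := fun x => μ x ≠ 0)
      fun x _ hx h0 => hx (by rw [h0, zero_smul])]
    refine (convex_convexHull ℝ I.feasible).sum_mem (fun x _ => hμ x) ?_ fun x hx => ?_
    · rw [Finset.sum_filter_ne_zero, hsum]
    · exact subset_convexHull ℝ _ ((hfeas x).2 (hbad x (Finset.mem_filter.1 hx).2))
  · intro w hw
    obtain ⟨x, rfl⟩ : ∃ x, w = pt x := by
      obtain ⟨x', hx', -, hg⟩ := hw
      obtain ⟨x, rfl⟩ := boolVec_surjective x'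
      exact ⟨x, Prod.ext hx' (funext fun j => (hg j).symm)⟩
    obtain ⟨z, hz, hzw⟩ := D.exists_isLocallyConsistent_of_point bad x ((hfeas x).1 hw)
    refine ⟨z, hz, ?_⟩
    rw [hπ (fun x' => if x' = x then 1 else 0) z fun t φ => by simp [hzw]]
    simp

theorem mainTheorem2 :
    ∃ C : ℝ, ∀ (n m p : ℕ) (I : BinaryProblem n m p) (τ : Type*) [Fintype τ]
      (D : TreeDecomposition I.intersectionGraph τ),
      ∃ (N M : ℕ) (L : LinearProgram N M),
        L.IsExactReformulation I ∧
        (N : ℝ) ≤ C * ((2 : ℝ) ^ D.width * ((Fintype.card τ : ℝ) + p)) ∧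
        (M : ℝ) ≤ C * ((2 : ℝ) ^ D.width * ((Fintype.card τ : ℝ) + p)) := by
  -- `12 = 6 * 2`: six from the inequality count, two because bags have up to `D.width + 1`
  -- elements.
  refine ⟨12, fun n m p I τ _ D => ?_⟩
  have hW : ∀ t, (D.bag t).card ≤ Finset.univ.sup fun t => (D.bag t).card :=
    fun t => Finset.le_sup (f := fun t => (D.bag t).card) (Finset.mem_univ t)
  obtain ⟨bad, π, hπ⟩ := I.exists_image_isLocallyConsistent_eq D
  obtain ⟨M, A, b, hM, hA⟩ := D.exists_linear_inequalities hW bad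
  have hset : {z | ∀ k, b k ≤ A k z} = {z | D.IsLocallyConsistent bad z} := Set.ext hA
  have hconv : Convex ℝ {z | D.IsLocallyConsistent bad z} := by
    rw [← hset, Set.ofPred_forall]
    exact convex_iInter fun k => convex_halfSpace_ge (A k).isLinear _
  obtain ⟨L, hL⟩ := I.exists_isExactReformulation A b π (by rw [hset, hπ hconv])
  have hN := D.card_localIndex_le hW
  have hpow : (2 : ℝ) ^ (Finset.univ.sup fun t => (D.bag t).card) = 2 * 2 ^ D.width := by
    rw [TreeDecomposition.width, zpow_sub_one₀ two_ne_zero, zpow_natCast]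
    ring
  have hp : 0 ≤ (2 : ℝ) ^ D.width * p := by positivity
  have hτ : 0 ≤ (2 : ℝ) ^ D.width * Fintype.card τ := by positivity
  refine ⟨_, M, L, hL, ?_, ?_⟩
  · have : (Fintype.card D.LocalIndex : ℝ) ≤
        Fintype.card τ * 2 ^ (Finset.univ.sup fun t => (D.bag t).card) := by exact_mod_cast hN
    rw [hpow] at this
    linarith
  · have : (M : ℝ) ≤
        6 * (Fintype.card τ * 2 ^ (Finset.univ.sup fun t => (D.bag t).card)) := by
      exact_mod_cast hM
    rw [hpow] at this
    linarith
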